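/- Consider a Markov decision process with state space $\mathcal X$, action space $\mathcal A$, finite horizon $H$, initial state distribution $p$, transition kernel $T(\cdot\mid x,a)$ and reward kernel $q(\cdot\mid x,a)$, and two Markov policies: the target policy $\pi$ and the behavior policy $\pi^b$. For a policy $\pi'$, let $P^{\pi'}_{X,Y}$ be the joint law of the initial state $X=x_1\sim p$ and the value $Y=\sum_{t=1}^H r_t$, where $a_t\sim\pi'(\cdot\mid x_t)$, $r_t\sim q(\cdot\mid x_t,a_t)$, $x_{t+1}\sim T(\cdot\mid x_t,a_t)$. Assume that for every $x\in\mathcal X$ the conditional law of $Y$ given $X=x$ under $\pi$ is absolutely continuous with respect to that under $\pi^b$, and let $w=\mathrm dP^{\pi}_{X,Y}/\mathrm dP^{\pi^b}_{X,Y}$. Let $n\ge 1$, let $(X_i,Y_i)_{i=1}^n$ be i.i.d. samples of $P^{\pi^b}_{X,Y}$, let $(X,Y)\sim P^{\pi}_{X,Y}$ be independent of them, and let $\mathbb P^{\pi^b,\pi}$ be the resulting joint law. Let $s:\mathcal X\times\mathbb R\to\mathbb R$ be a (measurable) score function, $V_i=s(X_i,Y_i)$, and $\alpha\in(0,1)$.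 Let $\hat w:\mathcal X\times\mathbb R\to[0,\infty)$ be a fixed (measurable) estimate of $w$, normalized so that $\mathbb E^{\pi^b}[\hat w(X,Y)]=1$. Put $$p_i^{\hat w}(x,y)=\frac{\hat w(X_i,Y_i)}{\sum_{j=1}^n\hat w(X_j,Y_j)+\hat w(x,y)}\ (i\le n),\qquad p_{n+1}^{\hat w}(x,y)=\frac{\hat w(x,y)}{\sum_{j=1}^n\hat w(X_j,Y_j)+\hat w(x,y)},$$ $$\hat F_n^{x,y}=\sum_{i=1}^n p_i^{\hat w}(x,y)\,\delta_{V_i}+p_{n+1}^{\hat w}(x,y)\,\delta_\infty,\qquad \hat C_n(x)=\{y\in\mathbb R:\ s(x,y)\le \mathrm{Quantile}_{1-\alpha}(\hat F_n^{x,y})\},$$ where $\mathrm{Quantile}_{\beta}(F)=\inf\{t\in[-\infty,\infty]:F([-\infty,t])\ge\beta\}$. Suppose that $\mathbb E^{\pi^b}[\hat w(X,Y)^r]\le M_r^r<\infty$ for some $r\ge 2$, and define $\Delta_w=\frac12\mathbb E^{\pi^b}|\hat w(X,Y)-w(X,Y)|$. Then $$\mathbb P^{\pi^b,\pi}\big[Y\in\hat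 C_n(X)\big]\ge 1-\alpha-\Delta_w .$$ If, in addition, the scores $V_1,\dots,V_n$ have no ties almost surely, then also $$\mathbb P^{\pi^b,\pi}\big[Y\in\hat C_n(X)\big]\le 1-\alpha+\Delta_w+c\,n^{1/r-1},$$ where $c>0$ is a constant that depends only on $M_r$ and $r$. -/

import Mathlib

open MeasureTheory ProbabilityTheory

universe u v

namespace ConformalOPE

/-- A finite time-horizon Markov decision process: horizon `H`, initial state distribution `p`,
transition kernel `T(· | x, a)` and reward kernel `q(· | x, a)`. -/
structure MDP (X : Type u) (A : Type v) [MeasurableSpace X] [MeasurableSpace A] where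
  /-- the horizon `H` -/
  horizon : ℕ
  /-- the initial state distribution `p` -/
  init : Measure X
  /-- the transition kernel `T` -/
  trans : Kernel (X × A) X
  /-- the reward kernel `q` -/
  reward : Kernel (X × A) ℝ
  isProb_init : IsProbabilityMeasure init
  isMarkov_trans : IsMarkovKernel trans
  isMarkov_reward : IsMarkovKernel reward

attribute [instance] MDP.isProb_init MDP.isMarkov_trans MDP.isMarkov_reward

section MDP

variable {X : Type u} {A : Type v} [MeasurableSpace X] [MeasurableSpace A]

/-- Prepend the first step `(x, a, r)` to a trajectory of length `h`. -/
def consTraj (h : ℕ) (z : X × ((A × ℝ) × (Fin h → X × A × ℝ))) : Fin (h + 1) → X × A × ℝ :=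
  Fin.cons (z.1, z.2.1.1, z.2.1.2) z.2.2

theorem measurable_consTraj (h : ℕ) : Measurable (consTraj (X := X) (A := A) h) := by
  refine measurable_pi_iff.2 fun i => ?_
  refine Fin.cases ?_ (fun j => ?_) i
  · simp only [consTraj, Fin.cons_zero]
    fun_prop
  · simp only [consTraj, Fin.cons_succ]
    fun_prop

/-- The conditional law, given the initial state `x₁ = x`, of the trajectory
`(x₁, a₁, r₁, …, x_h, a_h, r_h)` under the policy `π`:
`a_t ∼ π(· | x_t)`, `r_t ∼ q(· | x_t, a_t)`, `x_{t+1} ∼ T(· | x_t, a_t)`. -/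
noncomputable def trajKernel (M : MDP X A) (π : Kernel X A) :
    (h : ℕ) → Kernel X (Fin h → X × A × ℝ)
  | 0 => Kernel.const X (Measure.dirac Fin.elim0)
  | h + 1 =>
    (Kernel.id ×ₖ
      ((π ⊗ₖ M.reward) ⊗ₖ
        (trajKernel M π h ∘ₖ
          M.trans.comap (fun z : X × (A × ℝ) => (z.1, z.2.1)) (by fun_prop)))).map (consTraj h)

instance isMarkovKernel_trajKernel (M : MDP X A) (π : Kernel X A) [IsMarkovKernel π] (h : ℕ) :
    IsMarkovKernel (trajKernel M π h) := by
  induction h with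
  | zero => unfold trajKernel; infer_instance
  | succ h ih =>
    unfold trajKernel
    exact Kernel.IsMarkovKernel.map _ (measurable_consTraj h)

/-- The conditional law of the value `Y = ∑ₜ rₜ` of a trajectory given the initial state. -/
noncomputable def valueKernel (M : MDP X A) (π : Kernel X A) : Kernel X ℝ :=
  (trajKernel M π M.horizon).map (fun τ => ∑ t, (τ t).2.2)

instance isMarkovKernel_valueKernel (M : MDP X A) (π : Kernel X A) [IsMarkovKernel π] :
    IsMarkovKernel (valueKernel M π) :=
  Kernel.IsMarkovKernel.map _ (by fun_prop)

/-- The joint law `P^π_{X,Y}` of the initial state `X ∼ p` and the value `Y`. -/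
noncomputable def jointLaw (M : MDP X A) (π : Kernel X A) : Measure (X × ℝ) :=
  M.init ⊗ₘ valueKernel M π

instance isProbabilityMeasure_jointLaw (M : MDP X A) (π : Kernel X A) [IsMarkovKernel π] :
    IsProbabilityMeasure (jointLaw M π) := by
  unfold jointLaw; infer_instance

/-- The likelihood ratio `w = dP^π_{X,Y} / dP^{πb}_{X,Y}`. -/
noncomputable def likelihoodRatio (M : MDP X A) (π πb : Kernel X A) (z : X × ℝ) : ℝ :=
  ((jointLaw M π).rnDeriv (jointLaw M πb) z).toReal

/-- `Δ_w = (1/2) E^{πb} |ŵ(X, Y) - w(X, Y)|`. -/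
noncomputable def weightError (M : MDP X A) (π πb : Kernel X A) (wHat : X × ℝ → ℝ) : ℝ :=
  (1 / 2) * ∫ z, |wHat z - likelihoodRatio M π πb z| ∂(jointLaw M πb)

end MDP

section Conformal

variable {X : Type u}

/-- The normalized weight `v(z') / (∑ⱼ v(Xⱼ, Yⱼ) + v(z))`; it is `p_i^v(z)` for `z' = (X_i, Y_i)`
and `p_{n+1}^v(z)` for `z' = z`. -/
noncomputable def normWeight {n : ℕ} (v : X × ℝ → ℝ) (D : Fin n → X × ℝ) (z z' : X × ℝ) : ℝ :=
  v z' / (∑ j, v (D j) + v z)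

/-- The weighted score distribution `∑ᵢ p_i^v(x, y) δ_{V_i} + p_{n+1}^v(x, y) δ_∞`, with
`V_i = s(X_i, Y_i)`, as a measure on the extended reals. -/
noncomputable def scoreLaw {n : ℕ} (s : X → ℝ → ℝ) (v : X × ℝ → ℝ) (D : Fin n → X × ℝ)
    (x : X) (y : ℝ) : Measure EReal :=
  ∑ i, ENNReal.ofReal (normWeight v D (x, y) (D i)) •
      Measure.dirac ((s (D i).1 (D i).2 : ℝ) : EReal)
    + ENNReal.ofReal (normWeight v D (x, y) (x, y)) • Measure.dirac (⊤ : EReal)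

/-- The quantile of level `β`: `inf {t | F((-∞, t]) ≥ β}`. -/
noncomputable def quantile (β : ℝ) (F : Measure EReal) : EReal :=
  sInf {t : EReal | ENNReal.ofReal β ≤ F (Set.Iic t)}

/-- The conformalized set `Ĉ_n(x)` built from the calibration data `D` and the weights `v`. -/
noncomputable def conformalSet {n : ℕ} (s : X → ℝ → ℝ) (v : X × ℝ → ℝ) (α : ℝ)
    (D : Fin n → X × ℝ) (x : X) : Set ℝ :=
  {y : ℝ | ((s x y : ℝ) : EReal) ≤ quantile (1 - α) (scoreLaw s v D x y)}

/-- The coverage `ℙ[Y ∈ Ĉ_n(X)]`, where the calibration data are `n` i.i.d. samples of `Pb` and the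
test point `(X, Y) ∼ P` is independent of them. -/
noncomputable def coverage [MeasurableSpace X] (n : ℕ) (Pb P : Measure (X × ℝ))
    (s : X → ℝ → ℝ) (v : X × ℝ → ℝ) (α : ℝ) : ℝ :=
  ((Measure.pi fun _ : Fin n => Pb).prod P).real
    {ω : (Fin n → X × ℝ) × (X × ℝ) | ω.2.2 ∈ conformalSet s v α ω.1 ω.2.1}

end Conformal

end ConformalOPE

open ConformalOPE

/-!
Suppose first that the test point has the law of density `v = wHat` with respect to the behavior
law `Pb`. Put the calibration data and the test point together as `n + 1` i.i.d. points of law `Pb`,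
the test point reweighted by `v`. Unfolding the quantile (`mem_conformalSet_iff`), the test point is
missed exactly when the points of strictly smaller score carry at least `1 - α` of the total weight
of all `n + 1` points; this description no longer distinguishes calibration data from the test
point. By exchangeability, `n + 1` times the coverage is therefore the mean of the total weight of
the indices that would be covered as test point (`integral_sum_covered`). For every realization
this covered weight is at least `1 - α` times the total weight (`le_sum_covered`) and, without ties,
exceeds it by at most the largest weight (`sum_covered_le`). The total weight has mean `n + 1`, which
gives the lower bound `1 - α`. The largest weight is at most the `ℓ^r`-norm of the weights, whose
mean is at most `Mr * (n + 1) ^ (1 / r)` by Jensen's inequality (`integral_rpow_sum_rpow_le`), which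
gives the upper bound `1 - α + Mr * (n + 1) ^ (1 / r - 1)`.

Replacing the test law by the target law, of density `w`, costs at most the total variation distance
`Δ_w` (`abs_coverage_sub_le`). Absence of ties among `n ≥ 2` points passes to `n + 1` points
(`ae_injective_succ`); for `n = 1` the upper bound is at least `1` because `c ≥ 1`.
-/

namespace ConformalOPE

/-! ### Deterministic bounds on the covered weight -/

/-- Coverage of the score `V k` by the `β`-quantile of the scores weighted by `w`: the scores
strictly below `V k` do not already carry the proportion `β` of the total weight. If the total
weight vanishes, every score counts as covered. -/
def Covered {ι : Type*} [Fintype ι] (β : ℝ) (w V : ι → ℝ) (k : ι) : Prop :=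
  ¬ (0 < ∑ i, w i ∧ β * ∑ i, w i ≤ ∑ i, if V i < V k then w i else 0)

/-- The covered indices form a lower set for the order of the scores. The indices strictly below a
missed one of smallest score are all covered, and carry weight at least `β * ∑ i, w i`. -/
theorem le_sum_covered {ι : Type*} [Fintype ι] {β : ℝ} (hβ1 : β ≤ 1) (w V : ι → ℝ)
    (hw : ∀ i, 0 ≤ w i) [DecidablePred (Covered β w V)] :
    β * ∑ i, w i ≤ ∑ k, if Covered β w V k then w k else 0 := by
  classical
  have hW : 0 ≤ ∑ i, w i := Finset.sum_nonneg fun i _ => hw i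
  by_cases hall : ∀ k, Covered β w V k
  · simp only [hall, if_true]
    nlinarith
  · obtain ⟨k₀, hk₀⟩ := not_forall.1 hall
    obtain ⟨k, hk, hmin⟩ := (Finset.univ.filter fun k => ¬ Covered β w V k).exists_min_image V
      ⟨k₀, by simpa using hk₀⟩
    have hk' : ¬ Covered β w V k := by simpa using hk
    refine (not_not.1 hk').2.trans (Finset.sum_le_sum fun i _ => ?_)
    by_cases hi : V i < V k
    · have : Covered β w V i := by
        by_contra h
        exact absurd (hmin i (by simpa using h)) (not_le.2 hi)
      simp [hi, this]
    · rw [if_neg hi]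
      split_ifs
      exacts [hw i, le_rfl]

/-- Without ties, all covered indices but the one of largest score lie strictly below that one, so
they carry weight less than `β * ∑ i, w i`. -/
theorem sum_covered_le {ι : Type*} [Fintype ι] {β : ℝ} (hβ0 : 0 ≤ β) (w V : ι → ℝ)
    (hw : ∀ i, 0 ≤ w i) (hV : Function.Injective V) [DecidablePred (Covered β w V)]
    {m : ℝ} (hm0 : 0 ≤ m) (hm : ∀ i, w i ≤ m) :
    (∑ k, if Covered β w V k then w k else 0) ≤ β * ∑ i, w i + m := by
  classical
  have hW : 0 ≤ ∑ i, w i := Finset.sum_nonneg fun i _ => hw i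
  rcases hW.eq_or_lt with h0 | hpos
  · have hz : ∀ i, w i = 0 := fun i =>
      (Finset.sum_eq_zero_iff_of_nonneg fun i _ => hw i).1 h0.symm i (Finset.mem_univ i)
    simpa [hz] using hm0
  by_cases hne : (Finset.univ.filter fun k => Covered β w V k).Nonempty
  · obtain ⟨k, hk, hmax⟩ := Finset.exists_max_image _ V hne
    have hk' : Covered β w V k := by simpa using hk
    have hlt : (∑ i, if V i < V k then w i else 0) < β * ∑ i, w i := by
      by_contra h
      exact hk' ⟨hpos, not_lt.1 h⟩
    have hle : (∑ i, if Covered β w V i then w i else 0)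
        ≤ ∑ i, ((if V i < V k then w i else 0) + if i = k then w i else 0) := by
      refine Finset.sum_le_sum fun i _ => ?_
      by_cases hi : Covered β w V i
      · rcases (hmax i (by simpa using hi)).lt_or_eq with h | h
        · have : i ≠ k := fun e => by simp [e] at h
          simp [hi, h, this]
        · have : i = k := hV h
          subst this
          simp [hi]
      · rw [if_neg hi]
        have := hw i
        split_ifs <;> simp [this]
    rw [Finset.sum_add_distrib, Finset.sum_ite_eq' Finset.univ k w,
      if_pos (Finset.mem_univ k)] at hle
    linarith [hm k]
  · have : ∀ k, ¬ Covered β w V k := fun k hk => hne ⟨k, by simpa using hk⟩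
    simp only [this, if_false, Finset.sum_const_zero]
    positivity

/-! ### The conformal set in terms of the weights -/

section Conformal

variable {X : Type u}

/-- The test point lies in the conformal set unless the calibration scores strictly below its own
carry the proportion `1 - α` of the total weight. -/
theorem mem_conformalSet_iff {n : ℕ} (s : X → ℝ → ℝ) (v : X × ℝ → ℝ) (hv : ∀ z, 0 ≤ v z) {α : ℝ}
    (hα1 : α < 1) (D : Fin n → X × ℝ) (z : X × ℝ) :
    z.2 ∈ conformalSet s v α D z.1 ↔
      ¬ (0 < ∑ j, v (D j) + v z ∧ (1 - α) * (∑ j, v (D j) + v z) ≤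
        ∑ i, if s (D i).1 (D i).2 < s z.1 z.2 then v (D i) else 0) := by
  classical
  set T : ℝ := ∑ j, v (D j) + v z with hT
  have hT0 : 0 ≤ T := add_nonneg (Finset.sum_nonneg fun i _ => hv _) (hv z)
  have hp : ∀ i, 0 ≤ normWeight v D z (D i) := fun i => div_nonneg (hv _) hT0
  have hsum : (∑ i, if s (D i).1 (D i).2 < s z.1 z.2 then v (D i) else 0) / T =
      ∑ i, if s (D i).1 (D i).2 < s z.1 z.2 then normWeight v D z (D i) else 0 := by
    rw [Finset.sum_div]
    refine Finset.sum_congr rfl fun i _ => ?_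
    split_ifs
    · rfl
    · simp
  have hnn : ∀ i, 0 ≤ if s (D i).1 (D i).2 < s z.1 z.2 then normWeight v D z (D i) else 0 := by
    intro i
    split_ifs
    exacts [hp i, le_rfl]
  have hF : ∀ t : EReal, t < (s z.1 z.2 : EReal) → scoreLaw s v D z.1 z.2 (Set.Iic t) =
      ENNReal.ofReal (∑ i, if ((s (D i).1 (D i).2 : ℝ) : EReal) ≤ t
        then normWeight v D z (D i) else 0) := by
    intro t ht
    have htop : ¬ (⊤ : EReal) ≤ t := not_le.2 (ht.trans (EReal.coe_lt_top _))
    rw [ENNReal.ofReal_sum_of_nonneg]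
    · simp only [scoreLaw, Measure.coe_add, Pi.add_apply, Measure.coe_finsetSum,
        Finset.sum_apply, Measure.smul_apply, smul_eq_mul,
        Measure.dirac_apply' _ measurableSet_Iic, Set.indicator_apply, Set.mem_Iic, htop,
        if_false, mul_zero, add_zero]
      refine Finset.sum_congr rfl fun i _ => ?_
      split_ifs <;> simp
    · intro i _
      split_ifs
      exacts [hp i, le_rfl]
  rw [← not_iff_not, not_not]
  change ¬ (((s z.1 z.2 : ℝ) : EReal) ≤ quantile (1 - α) (scoreLaw s v D z.1 z.2)) ↔ _
  rw [not_le, quantile, sInf_lt_iff]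
  constructor
  · rintro ⟨t, ht, hlt⟩
    rw [Set.mem_ofPred_eq, hF t hlt, ENNReal.ofReal_le_ofReal_iff] at ht
    · have h1 : 1 - α ≤ (∑ i, if s (D i).1 (D i).2 < s z.1 z.2 then v (D i) else 0) / T := by
        rw [hsum]
        refine ht.trans (Finset.sum_le_sum fun i _ => ?_)
        by_cases hi : ((s (D i).1 (D i).2 : ℝ) : EReal) ≤ t
        · have : s (D i).1 (D i).2 < s z.1 z.2 := EReal.coe_lt_coe_iff.1 (hi.trans_lt hlt)
          simp [hi, this]
        · rw [if_neg hi]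
          exact hnn i
      have hTpos : 0 < T := by
        refine hT0.lt_of_ne fun h => ?_
        rw [← h, div_zero] at h1
        linarith
      exact ⟨hTpos, (le_div_iff₀ hTpos).1 h1⟩
    · refine Finset.sum_nonneg fun i _ => ?_
      split_ifs
      exacts [hp i, le_rfl]
  · rintro ⟨hTpos, hle⟩
    -- the largest calibration score strictly below the test score, or `⊥` if there is none
    let t : EReal := (Finset.univ.filter fun i => s (D i).1 (D i).2 < s z.1 z.2).sup
      fun i => ((s (D i).1 (D i).2 : ℝ) : EReal)
    have htlt : t < (s z.1 z.2 : EReal) := by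
      refine (Finset.sup_lt_iff (EReal.bot_lt_coe _)).2 fun i hi => ?_
      exact EReal.coe_lt_coe_iff.2 (by simpa using hi)
    refine ⟨t, ?_, htlt⟩
    rw [Set.mem_ofPred_eq, hF t htlt]
    refine ENNReal.ofReal_le_ofReal ?_
    rw [← le_div_iff₀ hTpos, hsum] at hle
    refine hle.trans (Finset.sum_le_sum fun i _ => ?_)
    by_cases hi : s (D i).1 (D i).2 < s z.1 z.2
    · have : ((s (D i).1 (D i).2 : ℝ) : EReal) ≤ t :=
        Finset.le_sup (f := fun i => ((s (D i).1 (D i).2 : ℝ) : EReal)) (by simpa using hi)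
      simp [hi, this]
    · rw [if_neg hi]
      split_ifs
      exacts [hp i, le_rfl]

/-- Splitting `n + 1` points into the `k`-th one as test point and the others as calibration data,
membership in the conformal set is coverage of the `k`-th score. -/
theorem mem_conformalSet_succAbove_iff {n : ℕ} (s : X → ℝ → ℝ) (v : X × ℝ → ℝ)
    (hv : ∀ z, 0 ≤ v z) {α : ℝ} (hα1 : α < 1) (D : Fin (n + 1) → X × ℝ) (k : Fin (n + 1)) :
    (D k).2 ∈ conformalSet s v α (fun j => D (k.succAbove j)) (D k).1 ↔
      Covered (1 - α) (fun i => v (D i)) (fun i => s (D i).1 (D i).2) k := by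
  rw [mem_conformalSet_iff s v hv hα1, Covered, Fin.sum_univ_succAbove _ k,
    Fin.sum_univ_succAbove _ k]
  simp [add_comm]

variable [MeasurableSpace X]

theorem measurableSet_coverage (n : ℕ) {s : X → ℝ → ℝ} (hs : Measurable (Function.uncurry s))
    {v : X × ℝ → ℝ} (hvm : Measurable v) (hv : ∀ z, 0 ≤ v z) {α : ℝ} (hα1 : α < 1) :
    MeasurableSet {ω : (Fin n → X × ℝ) × (X × ℝ) | ω.2.2 ∈ conformalSet s v α ω.1 ω.2.1} := by
  simp only [mem_conformalSet_iff s v hv hα1]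
  have hT : Measurable fun ω : (Fin n → X × ℝ) × (X × ℝ) => ∑ j, v (ω.1 j) + v ω.2 := by
    fun_prop
  have hS : Measurable fun ω : (Fin n → X × ℝ) × (X × ℝ) =>
      ∑ i, if s (ω.1 i).1 (ω.1 i).2 < s ω.2.1 ω.2.2 then v (ω.1 i) else 0 := by
    refine Finset.measurable_sum _ fun i _ => Measurable.ite ?_ (by fun_prop) measurable_const
    exact measurableSet_lt (hs.comp (by fun_prop : Measurable
      fun ω : (Fin n → X × ℝ) × (X × ℝ) => ω.1 i)) (hs.comp measurable_snd)
  exact ((measurableSet_lt measurable_const hT).inter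
    (measurableSet_le (hT.const_mul _) hS)).compl

end Conformal

/-! ### Change of weights -/

/-- For densities of equal mass the constant `1 / 2` can be subtracted from `g`, which is then at
most `1 / 2` in absolute value: this is the total variation bound, with its factor `1 / 2`. -/
theorem abs_integral_mul_sub_integral_mul_le {Z : Type*} [MeasurableSpace Z] {μ : Measure Z}
    {f₁ f₂ g : Z → ℝ} (h₁ : Integrable f₁ μ) (h₂ : Integrable f₂ μ)
    (heq : ∫ z, f₁ z ∂μ = ∫ z, f₂ z ∂μ) (hg : Measurable g) (hg0 : ∀ z, 0 ≤ g z)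
    (hg1 : ∀ z, g z ≤ 1) :
    |∫ z, f₁ z * g z ∂μ - ∫ z, f₂ z * g z ∂μ| ≤ (1 / 2) * ∫ z, |f₁ z - f₂ z| ∂μ := by
  have hint : ∀ f : Z → ℝ, Integrable f μ → Integrable (fun z => f z * g z) μ := fun f hf =>
    hf.mul_bdd (c := 1) hg.aestronglyMeasurable
      (.of_forall fun z => by simpa [abs_of_nonneg (hg0 z)] using hg1 z)
  have hd : Integrable (fun z => f₁ z - f₂ z) μ := h₁.sub h₂
  have key : ∫ z, f₁ z * g z ∂μ - ∫ z, f₂ z * g z ∂μ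
      = ∫ z, (f₁ z - f₂ z) * g z - (1 / 2) * (f₁ z - f₂ z) ∂μ := by
    rw [integral_sub (hint _ hd) (hd.const_mul _), integral_const_mul,
      integral_sub h₁ h₂, heq, sub_self, mul_zero, sub_zero, ← integral_sub (hint _ h₁) (hint _ h₂)]
    simp only [sub_mul]
  rw [key, ← integral_const_mul, ← Real.norm_eq_abs]
  refine norm_integral_le_of_norm_le (hd.abs.const_mul _) (.of_forall fun z => ?_)
  have hgz : |g z - 1 / 2| ≤ 1 / 2 := by
    rw [abs_le]
    constructor <;> linarith [hg0 z, hg1 z]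
  calc ‖(f₁ z - f₂ z) * g z - (1 / 2) * (f₁ z - f₂ z)‖
      = |g z - 1 / 2| * |f₁ z - f₂ z| := by rw [Real.norm_eq_abs, ← abs_mul]; ring_nf
    _ ≤ 1 / 2 * |f₁ z - f₂ z| := by gcongr

section Conformal

variable {X : Type u} [MeasurableSpace X]

/-- The probability, over `n` i.i.d. calibration points of law `Pb`, that the conformal set covers
the test point `z`. -/
noncomputable def pointCoverage (n : ℕ) (Pb : Measure (X × ℝ)) (s : X → ℝ → ℝ) (v : X × ℝ → ℝ)
    (α : ℝ) (z : X × ℝ) : ℝ :=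
  (Measure.pi fun _ : Fin n => Pb).real {D | z.2 ∈ conformalSet s v α D z.1}

theorem measurable_pointCoverage (n : ℕ) (Pb : Measure (X × ℝ)) [IsProbabilityMeasure Pb]
    {s : X → ℝ → ℝ} (hs : Measurable (Function.uncurry s))
    {v : X × ℝ → ℝ} (hvm : Measurable v) (hv : ∀ z, 0 ≤ v z) {α : ℝ} (hα1 : α < 1) :
    Measurable (pointCoverage n Pb s v α) :=
  (measurable_measure_prodMk_right (measurableSet_coverage n hs hvm hv hα1)).ennreal_toReal

theorem coverage_eq_integral_pointCoverage (n : ℕ) (Pb P : Measure (X × ℝ))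
    [IsProbabilityMeasure Pb] [IsProbabilityMeasure P]
    {s : X → ℝ → ℝ} (hs : Measurable (Function.uncurry s))
    {v : X × ℝ → ℝ} (hvm : Measurable v) (hv : ∀ z, 0 ≤ v z) {α : ℝ} (hα1 : α < 1) :
    coverage n Pb P s v α = ∫ z, pointCoverage n Pb s v α z ∂P := by
  have hE := measurableSet_coverage n hs hvm hv hα1
  rw [coverage, Measure.real, Measure.prod_apply_symm hE]
  refine (integral_toReal (measurable_measure_prodMk_right hE).aemeasurable
    (.of_forall fun z => measure_lt_top _ _)).symm

/-- Coverage under a test law `P` and under the test law of density `v` with respect to `Pb` differ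
by at most the total variation distance of these laws. -/
theorem abs_coverage_sub_le (n : ℕ) (Pb P : Measure (X × ℝ))
    [IsProbabilityMeasure Pb] [IsProbabilityMeasure P] (hac : P ≪ Pb)
    {s : X → ℝ → ℝ} (hs : Measurable (Function.uncurry s))
    {v : X × ℝ → ℝ} (hvm : Measurable v) (hv : ∀ z, 0 ≤ v z) (hvi : Integrable v Pb)
    (hv1 : ∫ z, v z ∂Pb = 1) {α : ℝ} (hα1 : α < 1) :
    |∫ z, v z * pointCoverage n Pb s v α z ∂Pb - coverage n Pb P s v α| ≤
      (1 / 2) * ∫ z, |v z - (P.rnDeriv Pb z).toReal| ∂Pb := by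
  rw [coverage_eq_integral_pointCoverage n Pb P hs hvm hv hα1, ← integral_rnDeriv_smul hac]
  refine abs_integral_mul_sub_integral_mul_le hvi Measure.integrable_toReal_rnDeriv ?_
    (measurable_pointCoverage n Pb hs hvm hv hα1) (fun z => measureReal_nonneg)
    (fun z => measureReal_le_one)
  rw [hv1, Measure.integral_toReal_rnDeriv hac, probReal_univ]

/-! ### Exchangeability -/

theorem measurePreserving_succAbove {Z : Type*} [MeasurableSpace Z] (μ : Measure Z)
    [IsProbabilityMeasure μ] (n : ℕ) (k : Fin (n + 1)) :
    MeasurePreserving (fun D : Fin (n + 1) → Z => (fun j => D (k.succAbove j)))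
      (Measure.pi fun _ => μ) (Measure.pi fun _ => μ) :=
  measurePreserving_snd.comp (measurePreserving_piFinSuccAbove (fun _ : Fin (n + 1) => μ) k)

theorem measurePreserving_prodMk_succAbove {Z : Type*} [MeasurableSpace Z] (μ : Measure Z)
    [IsProbabilityMeasure μ] (n : ℕ) (k : Fin (n + 1)) :
    MeasurePreserving (fun D : Fin (n + 1) → Z => ((fun j => D (k.succAbove j)), D k))
      (Measure.pi fun _ => μ) ((Measure.pi fun _ => μ).prod μ) :=
  Measure.measurePreserving_swap.comp
    (measurePreserving_piFinSuccAbove (fun _ : Fin (n + 1) => μ) k)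

open scoped Classical in
/-- Any of `n + 1` i.i.d. points may serve as the test point. -/
theorem integral_mul_pointCoverage (n : ℕ) (Pb : Measure (X × ℝ)) [IsProbabilityMeasure Pb]
    {s : X → ℝ → ℝ} (hs : Measurable (Function.uncurry s))
    {v : X × ℝ → ℝ} (hvm : Measurable v) (hv : ∀ z, 0 ≤ v z) (hvi : Integrable v Pb)
    {α : ℝ} (hα1 : α < 1) (k : Fin (n + 1)) :
    Integrable (fun D : Fin (n + 1) → X × ℝ =>
        if Covered (1 - α) (fun i => v (D i)) (fun i => s (D i).1 (D i).2) k then v (D k) else 0)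
        (Measure.pi fun _ => Pb) ∧
      ∫ D : Fin (n + 1) → X × ℝ,
        (if Covered (1 - α) (fun i => v (D i)) (fun i => s (D i).1 (D i).2) k then v (D k) else 0)
        ∂(Measure.pi fun _ => Pb) = ∫ z, v z * pointCoverage n Pb s v α z ∂Pb := by
  have hE := measurableSet_coverage n hs hvm hv hα1
  let E := {ω : (Fin n → X × ℝ) × (X × ℝ) | ω.2.2 ∈ conformalSet s v α ω.1 ω.2.1}
  let φ : (Fin n → X × ℝ) × (X × ℝ) → ℝ := E.indicator fun ω => v ω.2
  have hφi : Integrable φ ((Measure.pi fun _ => Pb).prod Pb) := (hvi.comp_snd _).indicator hE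
  have hmp := measurePreserving_prodMk_succAbove Pb n k
  have hφ : (fun D : Fin (n + 1) → X × ℝ =>
        if Covered (1 - α) (fun i => v (D i)) (fun i => s (D i).1 (D i).2) k then v (D k) else 0)
      = φ ∘ fun D => ((fun j => D (k.succAbove j)), D k) := by
    funext D
    simp only [φ, E, Function.comp, Set.indicator_apply, Set.mem_ofPred_eq]
    exact if_congr (mem_conformalSet_succAbove_iff s v hv hα1 D k).symm rfl rfl
  rw [hφ]
  refine ⟨hmp.integrable_comp_of_integrable hφi, ?_⟩
  simp only [Function.comp_def]
  rw [← integral_map hmp.measurable.aemeasurable (by rw [hmp.map_eq]; exact hφi.1), hmp.map_eq,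
    integral_prod_symm _ hφi]
  refine integral_congr_ae (.of_forall fun z => ?_)
  have hEz : MeasurableSet {D | z.2 ∈ conformalSet s v α D z.1} := measurable_prodMk_right hE
  change ∫ D, {D | z.2 ∈ conformalSet s v α D z.1}.indicator (fun _ => v z) D ∂_ = _
  rw [integral_indicator_const _ hEz, smul_eq_mul, mul_comm]
  rfl

open scoped Classical in
theorem integral_sum_covered (n : ℕ) (Pb : Measure (X × ℝ)) [IsProbabilityMeasure Pb]
    {s : X → ℝ → ℝ} (hs : Measurable (Function.uncurry s))
    {v : X × ℝ → ℝ} (hvm : Measurable v) (hv : ∀ z, 0 ≤ v z) (hvi : Integrable v Pb)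
    {α : ℝ} (hα1 : α < 1) :
    Integrable (fun D : Fin (n + 1) → X × ℝ => ∑ k,
        if Covered (1 - α) (fun i => v (D i)) (fun i => s (D i).1 (D i).2) k then v (D k) else 0)
        (Measure.pi fun _ => Pb) ∧
      ∫ D : Fin (n + 1) → X × ℝ, ∑ k,
        (if Covered (1 - α) (fun i => v (D i)) (fun i => s (D i).1 (D i).2) k then v (D k) else 0)
        ∂(Measure.pi fun _ => Pb) = (n + 1) * ∫ z, v z * pointCoverage n Pb s v α z ∂Pb := by
  have h := integral_mul_pointCoverage n Pb hs hvm hv hvi hα1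
  refine ⟨integrable_finsetSum _ fun k _ => (h k).1, ?_⟩
  rw [integral_finsetSum _ fun k _ => (h k).1, Finset.sum_congr rfl fun k _ => (h k).2]
  simp

theorem integral_sum_eval {Z : Type*} [MeasurableSpace Z] (μ : Measure Z) [IsProbabilityMeasure μ]
    (n : ℕ) {f : Z → ℝ} (hf : Integrable f μ) :
    Integrable (fun D : Fin n → Z => ∑ i, f (D i)) (Measure.pi fun _ => μ) ∧
      ∫ D : Fin n → Z, ∑ i, f (D i) ∂(Measure.pi fun _ => μ) = n * ∫ z, f z ∂μ := by
  have hmp := fun i => measurePreserving_eval (fun _ : Fin n => μ) i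
  have hi : ∀ i, Integrable (fun D : Fin n → Z => f (D i)) (Measure.pi fun _ => μ) := fun i =>
    (hmp i).integrable_comp_of_integrable hf
  refine ⟨integrable_finsetSum _ fun i _ => hi i, ?_⟩
  rw [integral_finsetSum _ fun i _ => hi i]
  have : ∀ i, ∫ D : Fin n → Z, f (D i) ∂(Measure.pi fun _ => μ) = ∫ z, f z ∂μ := fun i =>
    integral_comp_eval (μ := fun _ : Fin n => μ) (i := i) hf.1
  simp [this]

/-! ### Coverage under the reweighted test law -/

theorem le_integral_mul_pointCoverage (n : ℕ) (Pb : Measure (X × ℝ)) [IsProbabilityMeasure Pb]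
    {s : X → ℝ → ℝ} (hs : Measurable (Function.uncurry s))
    {v : X × ℝ → ℝ} (hvm : Measurable v) (hv : ∀ z, 0 ≤ v z) (hvi : Integrable v Pb)
    (hv1 : ∫ z, v z ∂Pb = 1) {α : ℝ} (hα0 : 0 ≤ α) (hα1 : α < 1) :
    1 - α ≤ ∫ z, v z * pointCoverage n Pb s v α z ∂Pb := by
  classical
  obtain ⟨hi, he⟩ := integral_sum_covered n Pb hs hvm hv hvi hα1
  obtain ⟨hTi, hT⟩ := integral_sum_eval Pb (n + 1) hvi
  have hn : (0 : ℝ) < n + 1 := by positivity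
  have := integral_mono (hTi.const_mul (1 - α)) hi fun D =>
    le_sum_covered (by linarith) (fun i => v (D i)) (fun i => s (D i).1 (D i).2) fun i => hv _
  rw [integral_const_mul, hT, he, hv1] at this
  push_cast at this
  nlinarith

/-- Two of `n + 1 ≥ 3` points always lie in a subfamily of `n` of them. -/
theorem ae_injective_succ {Z : Type*} [MeasurableSpace Z] (μ : Measure Z) [IsProbabilityMeasure μ]
    {n : ℕ} (hn : 2 ≤ n) {f : Z → ℝ}
    (h : ∀ᵐ D ∂(Measure.pi fun _ : Fin n => μ), Function.Injective fun i => f (D i)) :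
    ∀ᵐ D ∂(Measure.pi fun _ : Fin (n + 1) => μ), Function.Injective fun i => f (D i) := by
  have hall : ∀ᵐ D ∂(Measure.pi fun _ : Fin (n + 1) => μ), ∀ k : Fin (n + 1),
      Function.Injective fun j => f (D (k.succAbove j)) :=
    ae_all_iff.2 fun k => (measurePreserving_succAbove μ n k).quasiMeasurePreserving.ae h
  filter_upwards [hall] with D hD i j hij
  obtain ⟨k, hk⟩ : ∃ k, k ∉ ({i, j} : Finset (Fin (n + 1))) := by
    by_contra! hk
    have h1 := Finset.card_le_card (fun k _ => hk k : Finset.univ ⊆ ({i, j} : Finset _))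
    have h2 := Finset.card_le_two (a := i) (b := j)
    simp only [Finset.card_univ, Fintype.card_fin] at h1
    omega
  simp only [Finset.mem_insert, Finset.mem_singleton, not_or] at hk
  obtain ⟨i', rfl⟩ := Fin.exists_succAbove_eq (Ne.symm hk.1)
  obtain ⟨j', rfl⟩ := Fin.exists_succAbove_eq (Ne.symm hk.2)
  rw [hD k hij]

/-- The largest weight is at most the `ℓ^r`-norm of the weights, whose mean Jensen's inequality
bounds. -/
theorem integral_rpow_sum_rpow_le {Z : Type*} [MeasurableSpace Z] (μ : Measure Z)
    [IsProbabilityMeasure μ] (n : ℕ) {v : Z → ℝ} (hv : ∀ z, 0 ≤ v z) {r C : ℝ} (hr : 1 ≤ r)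
    (hC : 0 ≤ C) (hvr : Integrable (fun z => v z ^ r) μ) (hvC : ∫ z, v z ^ r ∂μ ≤ C ^ r) :
    Integrable (fun D : Fin n → Z => (∑ i, v (D i) ^ r) ^ (1 / r)) (Measure.pi fun _ => μ) ∧
      ∫ D : Fin n → Z, (∑ i, v (D i) ^ r) ^ (1 / r) ∂(Measure.pi fun _ => μ)
        ≤ (n : ℝ) ^ (1 / r) * C := by
  have hr0 : 0 < r := by linarith
  have hr1 : 1 / r ≤ 1 := by rw [div_le_one hr0]; exact hr
  obtain ⟨hi, he⟩ := integral_sum_eval μ n hvr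
  have hnn : ∀ D : Fin n → Z, 0 ≤ ∑ i, v (D i) ^ r := fun D =>
    Finset.sum_nonneg fun i _ => Real.rpow_nonneg (hv _) _
  have hgi : Integrable (fun D : Fin n → Z => (∑ i, v (D i) ^ r) ^ (1 / r))
      (Measure.pi fun _ => μ) := by
    refine (hi.add (integrable_const 1)).mono'
      (hi.1.aemeasurable.pow_const _).aestronglyMeasurable (.of_forall fun D => ?_)
    rw [Real.norm_of_nonneg (Real.rpow_nonneg (hnn D) _)]
    change _ ≤ (∑ i, v (D i) ^ r) + 1
    rcases le_total (∑ i, v (D i) ^ r) 1 with h | h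
    · linarith [Real.rpow_le_one (hnn D) h (by positivity : 0 ≤ 1 / r), hnn D]
    · have := Real.rpow_le_rpow_of_exponent_le h hr1
      rw [Real.rpow_one] at this
      linarith
  refine ⟨hgi, ?_⟩
  have hJ := (Real.concaveOn_rpow (by positivity : 0 ≤ 1 / r) hr1).le_map_integral
    (Real.continuous_rpow_const (by positivity : 0 ≤ 1 / r)).continuousOn isClosed_Ici
    (.of_forall hnn) hi hgi
  refine hJ.trans ?_
  rw [he]
  have hint : 0 ≤ ∫ z, v z ^ r ∂μ := integral_nonneg fun z => Real.rpow_nonneg (hv z) r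
  calc ((n : ℝ) * ∫ z, v z ^ r ∂μ) ^ (1 / r) ≤ ((n : ℝ) * C ^ r) ^ (1 / r) := by gcongr
    _ = (n : ℝ) ^ (1 / r) * C := by
      rw [Real.mul_rpow (by positivity) (by positivity), ← Real.rpow_mul hC,
        mul_one_div_cancel hr0.ne', Real.rpow_one]

theorem integral_mul_pointCoverage_le (n : ℕ) (Pb : Measure (X × ℝ)) [IsProbabilityMeasure Pb]
    {s : X → ℝ → ℝ} (hs : Measurable (Function.uncurry s))
    {v : X × ℝ → ℝ} (hvm : Measurable v) (hv : ∀ z, 0 ≤ v z) (hvi : Integrable v Pb)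
    (hv1 : ∫ z, v z ∂Pb = 1) {r C : ℝ} (hr : 1 ≤ r) (hC : 0 ≤ C)
    (hvr : Integrable (fun z => v z ^ r) Pb) (hvC : ∫ z, v z ^ r ∂Pb ≤ C ^ r)
    (hties : ∀ᵐ D ∂(Measure.pi fun _ : Fin (n + 1) => Pb),
      Function.Injective fun i => s (D i).1 (D i).2) {α : ℝ} (hα1 : α < 1) :
    ∫ z, v z * pointCoverage n Pb s v α z ∂Pb ≤ 1 - α + C * ((n : ℝ) + 1) ^ (1 / r - 1) := by
  classical
  have hr0 : 0 < r := by linarith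
  obtain ⟨hi, he⟩ := integral_sum_covered n Pb hs hvm hv hvi hα1
  obtain ⟨hTi, hT⟩ := integral_sum_eval Pb (n + 1) hvi
  obtain ⟨hMi, hM⟩ := integral_rpow_sum_rpow_le Pb (n + 1) hv hr hC hvr hvC
  have hn : (0 : ℝ) < n + 1 := by positivity
  have hmono := integral_mono_ae hi ((hTi.const_mul (1 - α)).add hMi) <| by
    filter_upwards [hties] with D hD
    have hnn : ∀ i, 0 ≤ v (D i) ^ r := fun i => Real.rpow_nonneg (hv _) _
    refine sum_covered_le (by linarith) (fun i => v (D i)) (fun i => s (D i).1 (D i).2)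
      (fun i => hv _) hD (Real.rpow_nonneg (Finset.sum_nonneg fun i _ => hnn i) _) fun i => ?_
    calc v (D i) = (v (D i) ^ r) ^ (1 / r) := by
          rw [← Real.rpow_mul (hv _), mul_one_div_cancel hr0.ne', Real.rpow_one]
      _ ≤ (∑ i, v (D i) ^ r) ^ (1 / r) :=
          Real.rpow_le_rpow (hnn i)
            (Finset.single_le_sum (f := fun i => v (D i) ^ r) (fun i _ => hnn i)
              (Finset.mem_univ i)) (by positivity)
  have hadd := integral_add (hTi.const_mul (1 - α)) hMi
  simp only [Pi.add_apply] at hmono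
  rw [hadd, integral_const_mul, hT, he, hv1] at hmono
  push_cast at hmono hM
  rw [Real.rpow_sub_one hn.ne', ← mul_le_mul_iff_right₀ hn]
  calc (n + 1) * ∫ z, v z * pointCoverage n Pb s v α z ∂Pb
      ≤ (1 - α) * ((n + 1) * 1) + ((n : ℝ) + 1) ^ (1 / r) * C := by linarith
    _ = (n + 1) * (1 - α + C * (((n : ℝ) + 1) ^ (1 / r) / (n + 1))) := by field_simp

end Conformal

end ConformalOPE

theorem proposition2 (Mr r : ℝ) (hMr : 0 ≤ Mr) (hr : 2 ≤ r) :
    ∃ c : ℝ, 0 < c ∧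
      ∀ (X : Type u) (A : Type v) [MeasurableSpace X] [MeasurableSpace A]
        (M : MDP X A) (π πb : Kernel X A) [IsMarkovKernel π] [IsMarkovKernel πb]
        (_hac : ∀ x, valueKernel M π x ≪ valueKernel M πb x)
        (s : X → ℝ → ℝ) (_hs : Measurable (Function.uncurry s))
        (wHat : X × ℝ → ℝ) (_hwm : Measurable wHat) (_hw0 : ∀ z, 0 ≤ wHat z)
        (_hw1 : ∫ z, wHat z ∂(jointLaw M πb) = 1)
        (_hwint : Integrable (fun z => wHat z ^ r) (jointLaw M πb))
        (_hwr : ∫ z, wHat z ^ r ∂(jointLaw M πb) ≤ Mr ^ r)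
        (α : ℝ) (_hα0 : 0 < α) (_hα1 : α < 1) (n : ℕ) (_hn : 1 ≤ n),
        1 - α - weightError M π πb wHat
            ≤ coverage n (jointLaw M πb) (jointLaw M π) s wHat α ∧
        ((∀ᵐ D ∂(Measure.pi fun _ : Fin n => jointLaw M πb),
            Function.Injective fun i => s (D i).1 (D i).2) →
          coverage n (jointLaw M πb) (jointLaw M π) s wHat α
            ≤ 1 - α + weightError M π πb wHat + c * (n : ℝ) ^ (1 / r - 1)) := by
  refine ⟨Mr + 1, by linarith, ?_⟩
  intro X A _ _ M π πb _ _ hac s hs v hvm hv hv1 hvr hvC α hα0 hα1 n hn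
  have hvi : Integrable v (jointLaw M πb) := .of_integral_ne_zero (by rw [hv1]; exact one_ne_zero)
  have hac' : jointLaw M π ≪ jointLaw M πb := .compProd_right (.of_forall hac)
  have hTV : |∫ z, v z * pointCoverage n (jointLaw M πb) s v α z ∂(jointLaw M πb) -
      coverage n (jointLaw M πb) (jointLaw M π) s v α| ≤ weightError M π πb v :=
    abs_coverage_sub_le n _ _ hac' hs hvm hv hvi hv1 hα1
  obtain ⟨hTV₁, hTV₂⟩ := abs_le.1 hTV
  refine ⟨?_, fun hties => ?_⟩
  · linarith [le_integral_mul_pointCoverage n (jointLaw M πb) hs hvm hv hvi hv1 hα0.le hα1]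
  · rcases hn.eq_or_lt with rfl | hn2
    · -- a single calibration score says nothing about ties with the test score, but the claimed
      -- bound exceeds `1`
      have h1 : coverage 1 (jointLaw M πb) (jointLaw M π) s v α ≤ 1 := measureReal_le_one
      have h2 := (abs_nonneg _).trans hTV
      rw [Nat.cast_one, Real.one_rpow]
      linarith
    · have hup := integral_mul_pointCoverage_le n (jointLaw M πb) hs hvm hv hvi hv1
        (by linarith : 1 ≤ r) hMr hvr hvC
        (ae_injective_succ _ hn2 (f := fun z : X × ℝ => s z.1 z.2) hties) hα1
      have hn0 : (0 : ℝ) < n := by exact_mod_cast hn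
      have hexp : 1 / r - 1 ≤ 0 := by
        rw [sub_nonpos, div_le_one (by linarith)]
        linarith
      have hle : ((n : ℝ) + 1) ^ (1 / r - 1) ≤ (n : ℝ) ^ (1 / r - 1) :=
        Real.rpow_le_rpow_of_nonpos hn0 (by linarith) hexp
      nlinarith [mul_le_mul_of_nonneg_left hle hMr, Real.rpow_nonneg hn0.le (1 / r - 1)]
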